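/- **Setting.** Let $G=(V,E)$ be a finite simple graph with $n=|V|\ge 1$ vertices, let $d,\alpha,\gamma$ be real numbers with $0<\gamma\le\alpha\le 10^{-2}$, let $c=10$, and write $\Delta(u)$ for the degree of $u$. Call $u$ a *high degree* vertex if $\Delta(u)>(1+\alpha)d$. Give each vertex the weight $W(u)=(1+\gamma)^{-1}$ if $\Delta(u)\le(1+\alpha)d$, and $W(u)=d^{c}\Delta(u)$ otherwise; the weight of a path $L$ is $\prod_{u\in L}W(u)$. A vertex $v$ is a *break-point* if every path of length at most $\frac{\ln n}{d^{2/5}}$ that starts from $v$ has weight at most $1$. An *influence path* is a path that contains no break-point; a vertex $u$ is reachable from $v$ through an influence path if there is a path from $v$ to $u$ none of whose vertices, except perhaps $v$, is a break-point. The set $\mathcal B=\mathcal B(\alpha,\gamma,c)$ of *blocks* consists of (1) for each cycle $C$ of $G$ of length at most $4\frac{\ln n}{\ln^5 d}$, the set of the vertices of $C$ and of all vertices reachable from a vertex of $C$ through an influence path; (2) for each vertex $v$ that lies in no block of type (1): the set $\{v\}$ if $v$ is a break-point, and otherwise the set of $v$ and all vertices reachable from $v$ through an influence path. The family $\mathcal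 G^A_d$ consists of the graphs $G$ that have no $t$-core (no nonempty subgraph of minimum degree at least $t$) for any integer $t\ge d$ and that satisfy: (A) $G$ can be properly coloured with $d$ colours or less; (B) each block $B\in\mathcal B$ induces a tree or a unicyclic graph (a tree with one extra edge); (C) for each block $B\in\mathcal B$, each vertex $u\notin B$ adjacent to some vertex of $B$, and each high degree vertex $u'\in B$, there is no path in $G$ from $u$ to $u'$ of weight greater than $1$. For an integer $k$, the chain $\mathcal M_c$ has as states the proper $k$-colourings of $G$. In one step from a state $X$ it chooses a block $B\in\mathcal B$ uniformly at random and moves to a uniformly random proper $k$-colouring among those that agree with $X$ outside $B$. Let $P_X$ denote the distribution of the next state. Let $H$ denote the Hamming distance. **Theorem 5.** Let $G\in\mathcal G^A_d$ be such that the blocks in $\mathcal B$ are pairwise disjoint (so that they partition $V$), and let $k\ge\frac{11}{2}d$. Let $X,Y$ be two states of $\mathcal M_c$ with $H(X,Y)=1$. Then there is a coupling $\nu_{X,Y}$ of $P_X$ and $P_Y$ such that, for $(X',Y')$ distributed as $\nu_{X,Y}$, $$\mathbb E_{\nu_{X,Y}}[H(X',Y')]\le 1-\frac{0.1225}{n}.$$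 -/

import Mathlib

namespace BlockColouring

noncomputable section

variable {V : Type*} [Fintype V]

/-- The degree `Δ(u)` of a vertex. -/
def deg (G : SimpleGraph V) (u : V) : ℕ :=
  open scoped Classical in G.degree u

/-- `u` is a high degree vertex: `Δ(u) > (1 + α) d`. -/
def IsHigh (G : SimpleGraph V) (d α : ℝ) (u : V) : Prop :=
  (1 + α) * d < (deg G u : ℝ)

/-- The weight `W(u)`: it is `(1 + γ)⁻¹` if `Δ(u) ≤ (1 + α) d`, and `d ^ c * Δ(u)` otherwise. -/
def weight (G : SimpleGraph V) (d α γ c : ℝ) (u : V) : ℝ :=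
  open scoped Classical in
  if (deg G u : ℝ) ≤ (1 + α) * d then (1 + γ)⁻¹ else d ^ c * (deg G u : ℝ)

/-- The weight of a walk: the product of the weights of its vertices (both ends included). -/
def pathWeight (G : SimpleGraph V) (d α γ c : ℝ) {u v : V} (p : G.Walk u v) : ℝ :=
  (p.support.map (weight G d α γ c)).prod

/-- The weights of the paths of length (number of edges) at most `ln n / d ^ (2/5)` that start
from `v`, where `n` is the number of vertices. This is a finite set; it contains the weight of
the path of length zero. -/
def shortPathWeights (G : SimpleGraph V) (d α γ c : ℝ) (v : V) : Set ℝ :=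
  {x | ∃ (u : V) (p : G.Walk v u), p.IsPath ∧
    (p.length : ℝ) ≤ Real.log (Fintype.card V) / d ^ ((2 : ℝ) / 5) ∧
    x = pathWeight G d α γ c p}

/-- The influence `E(v)` on the vertex `v`: the largest weight of a path of length at most
`ln n / d ^ (2/5)` that starts from `v`. -/
def influence (G : SimpleGraph V) (d α γ c : ℝ) (v : V) : ℝ :=
  sSup (shortPathWeights G d α γ c v)

/-- `v` is a break-point: the influence on `v` is at most one. -/
def IsBreakPoint (G : SimpleGraph V) (d α γ c : ℝ) (v : V) : Prop :=
  influence G d α γ c v ≤ 1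

/-- `u` is `v` itself, or `u` is reachable from `v` through an influence path: there is a path
from `v` to `u` along which no vertex, except perhaps the starting vertex `v`, is a break-point.
If `v` is not a break-point, this says that some path from `v` to `u` contains no break-point. If
`v` is a break-point (which matters for vertices on short cycles only), the path that contains no
break-point begins at a neighbour of `v`; so the outer boundary of every block with more than one
vertex consists of break-points. -/
def InfluenceReachable (G : SimpleGraph V) (d α γ c : ℝ) (v u : V) : Prop :=
  ∃ p : G.Walk v u, p.IsPath ∧ ∀ x ∈ p.support.tail, ¬ IsBreakPoint G d α γ c x

/-- The closed walk `p` is a cycle of length at most `4 ln n / ln⁵ d`. -/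
def IsShortCycle (G : SimpleGraph V) (d : ℝ) {v : V} (p : G.Walk v v) : Prop :=
  p.IsCycle ∧ (p.length : ℝ) ≤ 4 * (Real.log (Fintype.card V) / Real.log d ^ 5)

/-- The block of a cycle: the vertices of the cycle, and the vertices that are reachable from
them through an influence path. -/
def cycleBlock (G : SimpleGraph V) (d α γ c : ℝ) {v : V} (p : G.Walk v v) : Set V :=
  {u | ∃ x ∈ p.support, InfluenceReachable G d α γ c x u}

/-- `B` is a block of the first kind: the block of some short cycle. -/
def IsCycleBlock (G : SimpleGraph V) (d α γ c : ℝ) (B : Set V) : Prop :=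
  ∃ (v : V) (p : G.Walk v v), IsShortCycle G d p ∧ B = cycleBlock G d α γ c p

/-- `B` is a block of the second kind: the block of a vertex `v` that lies in no block of the
first kind. It is `{v}` if `v` is a break-point; otherwise it consists of `v` and the vertices
that are reachable from `v` through an influence path. -/
def IsRemainingBlock (G : SimpleGraph V) (d α γ c : ℝ) (B : Set V) : Prop :=
  ∃ v : V, (∀ B' : Set V, IsCycleBlock G d α γ c B' → v ∉ B') ∧
    ((IsBreakPoint G d α γ c v ∧ B = {v}) ∨
      (¬ IsBreakPoint G d α γ c v ∧ B = {u | InfluenceReachable G d α γ c v u}))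

/-- The set of blocks `𝓑(α, γ, c)`. -/
def blocks (G : SimpleGraph V) (d α γ c : ℝ) : Finset (Finset V) :=
  open scoped Classical in
  Finset.univ.filter fun B =>
    IsCycleBlock G d α γ c (B : Set V) ∨ IsRemainingBlock G d α γ c (B : Set V)

/-- Every vertex lies in some block. -/
theorem exists_mem_blocks (G : SimpleGraph V) (d α γ c : ℝ) (v : V) :
    ∃ B ∈ blocks G d α γ c, v ∈ B := by
  classical
  have key : ∀ S : Set V, (IsCycleBlock G d α γ c S ∨ IsRemainingBlock G d α γ c S) → v ∈ S →
      ∃ B ∈ blocks G d α γ c, v ∈ B := by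
    intro S hS hv
    refine ⟨S.toFinset, ?_, by simpa using hv⟩
    simpa [blocks] using hS
  by_cases h : ∃ S : Set V, IsCycleBlock G d α γ c S ∧ v ∈ S
  · obtain ⟨S, hS, hv⟩ := h
    exact key S (Or.inl hS) hv
  · have h' : ∀ S : Set V, IsCycleBlock G d α γ c S → v ∉ S := fun S hS hv => h ⟨S, hS, hv⟩
    by_cases hb : IsBreakPoint G d α γ c v
    · exact key {v} (Or.inr ⟨v, h', Or.inl ⟨hb, rfl⟩⟩) rfl
    · exact key {u | InfluenceReachable G d α γ c v u} (Or.inr ⟨v, h', Or.inr ⟨hb, rfl⟩⟩)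
        ⟨SimpleGraph.Walk.nil, SimpleGraph.Walk.IsPath.nil, by simp⟩

theorem blocks_nonempty [Nonempty V] (G : SimpleGraph V) (d α γ c : ℝ) :
    (blocks G d α γ c).Nonempty := by
  obtain ⟨B, hB, _⟩ := exists_mem_blocks G d α γ c (Classical.arbitrary V)
  exact ⟨B, hB⟩

/-- The (outer) boundary of `B`: the vertices outside `B` that are adjacent to a vertex in `B`. -/
def outerBoundary (G : SimpleGraph V) (B : Finset V) : Set V :=
  {u | u ∉ B ∧ ∃ x ∈ B, G.Adj u x}

/-- A unicyclic graph: a tree with exactly one extra edge. -/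
def IsUnicyclic {W : Type*} (H : SimpleGraph W) : Prop :=
  ∃ e ∈ H.edgeSet, (H.deleteEdges {e}).IsTree

/-- `G` has no `t`-core: no nonempty set of vertices induces a subgraph in which every vertex has
degree at least `t`. -/
def HasNoCore (G : SimpleGraph V) (t : ℕ) : Prop :=
  ¬ ∃ S : Set V, S.Nonempty ∧ ∀ v ∈ S, t ≤ {u | u ∈ S ∧ G.Adj v u}.ncard

/-- The family `𝓖ᴬ_d` of graphs, for the parameters `α`, `γ` and with `c = 10`. -/
structure IsInFamily (G : SimpleGraph V) (d α γ : ℝ) : Prop where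
  /-- there is no `t`-core for `t ≥ d` -/
  no_core : ∀ t : ℕ, d ≤ (t : ℝ) → HasNoCore G t
  /-- (A) the graph can be coloured with `d` colours or less -/
  colorable : ∃ m : ℕ, (m : ℝ) ≤ d ∧ G.Colorable m
  /-- (B) each block is a tree or a unicyclic graph -/
  simple_blocks : ∀ B ∈ blocks G d α γ 10,
    (G.induce (B : Set V)).IsTree ∨ IsUnicyclic (G.induce (B : Set V))
  /-- (C) no path between a vertex at the outer boundary of a block and a high degree vertex in
  the block has weight greater than one -/
  light_paths : ∀ B ∈ blocks G d α γ 10, ∀ u ∈ outerBoundary G B, ∀ u' ∈ B, IsHigh G d α u' →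
    ∀ p : G.Walk u u', p.IsPath → ¬ 1 < pathWeight G d α γ 10 p

/-- The proper `k`-colourings that agree with `X` outside `B`. -/
def agreeingColourings (G : SimpleGraph V) {k : ℕ} (X : G.Coloring (Fin k)) (B : Finset V) :
    Finset (G.Coloring (Fin k)) :=
  open scoped Classical in
  Finset.univ.filter fun Z => ∀ u, u ∉ B → Z u = X u

theorem agreeingColourings_nonempty (G : SimpleGraph V) {k : ℕ} (X : G.Coloring (Fin k))
    (B : Finset V) : (agreeingColourings G X B).Nonempty :=
  ⟨X, by simp [agreeingColourings]⟩

/-- The update of the block `B` at the state `X`: the Gibbs distribution (the uniform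
distribution on the proper `k`-colourings) conditional on agreeing with `X` outside `B`. -/
def blockUpdate (G : SimpleGraph V) {k : ℕ} (X : G.Coloring (Fin k)) (B : Finset V) :
    PMF (G.Coloring (Fin k)) :=
  PMF.uniformOfFinset (agreeingColourings G X B) (agreeingColourings_nonempty G X B)

/-- The one step transition probabilities `P_X` of the chain `𝓜_c` from the state `X`: choose a
block uniformly at random from `𝓑(α, γ, c)`, and update it. -/
def step [Nonempty V] (G : SimpleGraph V) (d α γ c : ℝ) {k : ℕ} (X : G.Coloring (Fin k)) :
    PMF (G.Coloring (Fin k)) :=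
  (PMF.uniformOfFinset (blocks G d α γ c) (blocks_nonempty G d α γ c)).bind (blockUpdate G X)

/-- `ν` is a coupling of `P` and `Q`. -/
def IsCoupling {S : Type*} (ν : PMF (S × S)) (P Q : PMF S) : Prop :=
  ν.map Prod.fst = P ∧ ν.map Prod.snd = Q

/-- The expected Hamming distance of a pair of colourings distributed as in `ν`. -/
def expectedHamming {G : SimpleGraph V} {k : ℕ}
    (ν : PMF (G.Coloring (Fin k) × G.Coloring (Fin k))) : ℝ :=
  ∑ q, (ν q).toReal * (hammingDist (q.1 : V → Fin k) (q.2 : V → Fin k) : ℝ)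

end

end BlockColouring

set_option linter.unusedSectionVars false

namespace BlockColouring

/-! ### Transport cost between weights on a finite type -/

section Coupling

variable {Ω : Type*} [Fintype Ω]

/-! Let `s` be the vertex where `X` and `Y` disagree. If the updated block contains `s`, both
updates have the same law and the distance drops to 0. Any other block `B` sees the disagreement
only through the neighbours of `s` in `B`, and the claim is that its update has expected distance at
most `1 + |N(s) ∩ B| κ`, with `κ = costBound d (W(s))`. Blocks are disjoint, so summing over them
bounds the extra cost by `Δ(s) κ`. By (C), `s` has low degree if it has a neighbour outside its
block, and then `Δ(s) κ ≤ 0.8775 = 1 - 0.1225`. There are at most `n` blocks, which gives the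
theorem.

The bound for one block is a recursion on uniform list colourings. Moving `s` from one colour to
another means lifting one forbidden colour at its neighbours in `B`, changing `s`, and forbidding
another colour (`close_recolour`). Forbidding a colour at a single vertex `w` matters only for the
fraction of colourings that use it there, at most `1 / (k - Δ(w))`. Those are coupled to the rest by
recolouring `w`, which is the same problem on the set without `w` (`close_forbid_singleton`). The
recursion thus branches along simple paths from `s`.

`close_forbid_of_light` solves it with the potential `(0.82 + 0.01 / W) / (2 d)`, where `W` is the
weight of the path so far. At a low degree vertex the factor `1 / (k - Δ)` beats the branching. At a
high degree vertex only the trivial factor 1 is used, but by (C) the path up to and including that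
vertex has weight at most 1, so the term `1 / W` is already large enough to pay for all its
neighbours. -/

/-- The weights `μ` and `ν` have a coupling of expected cost at most `r`. -/
def Close (D : Ω → Ω → ℝ) (μ ν : Ω → ℝ) (r : ℝ) : Prop :=
  ∃ π : Ω → Ω → ℝ, (∀ x y, 0 ≤ π x y) ∧ (∀ x, ∑ y, π x y = μ x) ∧ (∀ y, ∑ x, π x y = ν y) ∧
    ∑ x, ∑ y, π x y * D x y ≤ r

theorem Close.mono {D : Ω → Ω → ℝ} {μ ν : Ω → ℝ} {r s : ℝ} (h : Close D μ ν r) (hrs : r ≤ s) :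
    Close D μ ν s := by
  obtain ⟨π, h0, h1, h2, h3⟩ := h
  exact ⟨π, h0, h1, h2, h3.trans hrs⟩

theorem Close.symm {D : Ω → Ω → ℝ} (hD : ∀ x y, D x y = D y x) {μ ν : Ω → ℝ} {r : ℝ}
    (h : Close D μ ν r) : Close D ν μ r := by
  obtain ⟨π, h0, h1, h2, h3⟩ := h
  refine ⟨fun x y => π y x, fun x y => h0 y x, h2, h1, ?_⟩
  rw [Finset.sum_comm]
  simpa only [hD] using h3

theorem Close.refl {D : Ω → Ω → ℝ} (hD : ∀ x, D x x = 0) {μ : Ω → ℝ} (hμ : ∀ x, 0 ≤ μ x) :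
    Close D μ μ 0 := by
  classical
  refine ⟨fun x y => if x = y then μ x else 0, ?_, ?_, ?_, ?_⟩
  · intro x y
    dsimp only
    split_ifs
    · exact hμ x
    · exact le_rfl
  · simp
  · simp
  · simp [hD]

/-- Gluing: the two couplings are made conditionally independent given the middle coordinate.
Division by `ν y = 0` is harmless, since the couplings then vanish at `y`. -/
theorem Close.trans {D : Ω → Ω → ℝ} (hD : ∀ x y z, D x z ≤ D x y + D y z) {μ ν ξ : Ω → ℝ}
    {r s : ℝ} (h : Close D μ ν r) (h' : Close D ν ξ s) : Close D μ ξ (r + s) := by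
  obtain ⟨π, h0, h1, h2, h3⟩ := h
  obtain ⟨σ, k0, k1, k2, k3⟩ := h'
  have hν : ∀ y, 0 ≤ ν y := fun y => by rw [← h2]; exact Finset.sum_nonneg fun x _ => h0 x y
  have hπ0 : ∀ x y, ν y = 0 → π x y = 0 := fun x y hy =>
    (Finset.sum_eq_zero_iff_of_nonneg fun x _ => h0 x y).1 ((h2 y).trans hy) x (Finset.mem_univ _)
  have hσ0 : ∀ y z, ν y = 0 → σ y z = 0 := fun y z hy =>
    (Finset.sum_eq_zero_iff_of_nonneg fun z _ => k0 y z).1 ((k1 y).trans hy) z (Finset.mem_univ _)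
  have e1 : ∀ x y, ∑ z, π x y * σ y z / ν y = π x y := by
    intro x y
    rw [← Finset.sum_div, ← Finset.mul_sum, k1]
    by_cases hy : ν y = 0
    · simp [hy, hπ0 x y hy]
    · field_simp
  have e2 : ∀ y z, ∑ x, π x y * σ y z / ν y = σ y z := by
    intro y z
    rw [← Finset.sum_div, ← Finset.sum_mul, h2]
    by_cases hy : ν y = 0
    · simp [hy, hσ0 y z hy]
    · field_simp
  have nn : ∀ x y z, 0 ≤ π x y * σ y z / ν y := fun x y z =>
    div_nonneg (mul_nonneg (h0 x y) (k0 y z)) (hν y)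
  refine ⟨fun x z => ∑ y, π x y * σ y z / ν y, fun x z => Finset.sum_nonneg fun y _ => nn x y z,
    ?_, ?_, ?_⟩
  · intro x
    rw [Finset.sum_comm]
    simp only [e1, h1]
  · intro z
    rw [Finset.sum_comm]
    simp only [e2, k2]
  · calc ∑ x, ∑ z, (∑ y, π x y * σ y z / ν y) * D x z
        ≤ ∑ x, ∑ z, ∑ y, (π x y * σ y z / ν y * D x y + π x y * σ y z / ν y * D y z) := by
          refine Finset.sum_le_sum fun x _ => Finset.sum_le_sum fun z _ => ?_
          rw [Finset.sum_mul]
          refine Finset.sum_le_sum fun y _ => ?_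
          rw [← mul_add]
          exact mul_le_mul_of_nonneg_left (hD x y z) (nn x y z)
      _ = (∑ x, ∑ y, π x y * D x y) + ∑ y, ∑ z, σ y z * D y z := by
          simp only [Finset.sum_add_distrib]
          congr 1
          · refine Finset.sum_congr rfl fun x _ => ?_
            rw [Finset.sum_comm]
            refine Finset.sum_congr rfl fun y _ => ?_
            rw [← Finset.sum_mul, e1]
          · rw [Finset.sum_comm' (t' := Finset.univ) (s' := fun _ => Finset.univ) (by simp)]
            rw [Finset.sum_comm (s := (Finset.univ : Finset Ω)) (t := (Finset.univ : Finset Ω))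
              (f := fun y z => σ y z * D y z)]
            refine Finset.sum_congr rfl fun z _ => ?_
            rw [Finset.sum_comm]
            refine Finset.sum_congr rfl fun y _ => ?_
            rw [← Finset.sum_mul, e2]
      _ ≤ r + s := add_le_add h3 k3

theorem Close.mixture {D : Ω → Ω → ℝ} {ι : Type*} (s : Finset ι) {t : ι → ℝ}
    (ht : ∀ i ∈ s, 0 ≤ t i) {μ ν : ι → Ω → ℝ} {r : ι → ℝ}
    (h : ∀ i ∈ s, Close D (μ i) (ν i) (r i)) :
    Close D (fun x => ∑ i ∈ s, t i * μ i x) (fun x => ∑ i ∈ s, t i * ν i x)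
      (∑ i ∈ s, t i * r i) := by
  choose! π h0 h1 h2 h3 using h
  refine ⟨fun x y => ∑ i ∈ s, t i * π i x y,
    fun x y => Finset.sum_nonneg fun i hi => mul_nonneg (ht i hi) (h0 i hi x y), ?_, ?_, ?_⟩
  · intro x
    rw [Finset.sum_comm]
    refine Finset.sum_congr rfl fun i hi => ?_
    rw [← Finset.mul_sum, h1 i hi]
  · intro y
    rw [Finset.sum_comm]
    refine Finset.sum_congr rfl fun i hi => ?_
    rw [← Finset.mul_sum, h2 i hi]
  · have : ∑ x, ∑ y, (∑ i ∈ s, t i * π i x y) * D x y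
        = ∑ i ∈ s, t i * ∑ x, ∑ y, π i x y * D x y := by
      simp only [Finset.sum_mul, Finset.mul_sum, mul_assoc]
      rw [Finset.sum_comm (s := s)]
      refine Finset.sum_congr rfl fun x _ => ?_
      rw [Finset.sum_comm]
    rw [this]
    exact Finset.sum_le_sum fun i hi => mul_le_mul_of_nonneg_left (h3 i hi) (ht i hi)

/-- Converts real-valued couplings, in which all estimates are made, back to `PMF`. -/
theorem Close.toPMF {D : Ω → Ω → ℝ} {P Q : PMF Ω} {r : ℝ}
    (h : Close D (fun x => (P x).toReal) (fun x => (Q x).toReal) r) :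
    ∃ ν : PMF (Ω × Ω), IsCoupling ν P Q ∧ ∑ x, ∑ y, (ν (x, y)).toReal * D x y ≤ r := by
  classical
  obtain ⟨π, h0, h1, h2, h3⟩ := h
  have c1 : ∀ x, ∑ y, ENNReal.ofReal (π x y) = P x := fun x => by
    rw [← ENNReal.ofReal_sum_of_nonneg fun y _ => h0 x y, h1, ENNReal.ofReal_toReal (P.apply_ne_top x)]
  have c2 : ∀ y, ∑ x, ENNReal.ofReal (π x y) = Q y := fun y => by
    rw [← ENNReal.ofReal_sum_of_nonneg fun x _ => h0 x y, h2, ENNReal.ofReal_toReal (Q.apply_ne_top y)]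
  have tot : ∑ p : Ω × Ω, ENNReal.ofReal (π p.1 p.2) = 1 := by
    rw [Fintype.sum_prod_type]
    simp only [c1]
    rw [← tsum_fintype (L := .unconditional _)]
    exact P.tsum_coe
  refine ⟨PMF.ofFintype (fun p => ENNReal.ofReal (π p.1 p.2)) tot, ⟨?_, ?_⟩, ?_⟩
  · ext x
    rw [PMF.map_apply, tsum_fintype, Fintype.sum_prod_type, ← c1 x, Finset.sum_eq_single x]
    · simp
    · intro y _ hy
      simp [hy.symm]
    · simp
  · ext y
    rw [PMF.map_apply, tsum_fintype, Fintype.sum_prod_type, ← c2 y]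
    simp
  · simpa [ENNReal.toReal_ofReal, h0] using h3

end Coupling

/-! ### Couplings of uniform distributions -/

section Uniform

variable {Ω : Type*} [DecidableEq Ω]

/-- The uniform distribution on a finite set, as a real function. -/
noncomputable def unif (A : Finset Ω) (x : Ω) : ℝ := if x ∈ A then (A.card : ℝ)⁻¹ else 0

theorem unif_nonneg (A : Finset Ω) (x : Ω) : 0 ≤ unif A x := by
  unfold unif; split_ifs <;> positivity

/-- A uniform distribution is the mixture of the uniform distributions on its fibres. -/
theorem unif_eq_mixture {ι : Type*} [Fintype ι] [DecidableEq ι] (A : Finset Ω) (f : Ω → ι)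
    (x : Ω) : unif A x = ∑ i, ((A.filter (f · = i)).card / A.card : ℝ) *
      unif (A.filter (f · = i)) x := by
  rw [Finset.sum_eq_single (f x)]
  · unfold unif
    by_cases hx : x ∈ A
    · have h : x ∈ A.filter (f · = f x) := by simp [hx]
      have : ((A.filter (f · = f x)).card : ℝ) ≠ 0 := by
        exact_mod_cast (Finset.card_pos.2 ⟨x, h⟩).ne'
      simp only [hx, h, if_true]
      field_simp
    · simp [hx]
  · intro i _ hi
    simp [unif, hi.symm]
  · simp

variable [Fintype Ω]

/-- `unif A` is a mixture of its fibres, so coupling `μ` to each nonempty fibre suffices. Empty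
fibres are excluded because their `unif` is zero and has no coupling with a probability weight. -/
theorem Close.unif_fibres {ι : Type*} [Fintype ι] [DecidableEq ι] {D : Ω → Ω → ℝ} {μ : Ω → ℝ}
    {A : Finset Ω} (hA : A.Nonempty) (f : Ω → ι) {r : ℝ}
    (h : ∀ i, (A.filter (f · = i)).Nonempty → Close D μ (unif (A.filter (f · = i))) r) :
    Close D μ (unif A) r := by
  set s : Finset ι := Finset.univ.filter fun i => (A.filter (f · = i)).Nonempty with hs
  have hcard : (A.card : ℝ) ≠ 0 := by exact_mod_cast hA.card_pos.ne'
  have hz : ∀ i, i ∉ s → (A.filter (f · = i)).card = 0 := by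
    intro i hi
    simpa [hs, Finset.card_eq_zero, Finset.not_nonempty_iff_eq_empty] using hi
  have h1 : ∑ i ∈ s, ((A.filter (f · = i)).card / A.card : ℝ) = 1 := by
    rw [Finset.sum_subset (Finset.subset_univ s) fun i _ hi => by simp [hz i hi],
      ← Finset.sum_div, ← Nat.cast_sum,
      ← Finset.card_eq_sum_card_fiberwise (fun x _ => Finset.mem_coe.2 (Finset.mem_univ (f x))),
      div_self hcard]
  have key := Close.mixture (D := D) s (t := fun i => ((A.filter (f · = i)).card / A.card : ℝ))
    (fun i _ => by positivity) (μ := fun _ => μ) (ν := fun i => unif (A.filter (f · = i)))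
    (r := fun _ => r) (fun i hi => h i (by simpa [hs] using hi))
  simp only [← Finset.sum_mul, h1, one_mul] at key
  convert key using 1
  funext x
  rw [unif_eq_mixture A f x]
  exact (Finset.sum_subset (Finset.subset_univ s) fun i _ hi => by simp [hz i hi]).symm

/-- A uniform point of `Z` lies outside `A` with probability `1 - |A| / |Z|`, and is then uniform on
`Z \ A` and need not move. Only the part in `A` pays. -/
theorem Close.unif_subset {D : Ω → Ω → ℝ} (hD : ∀ x, D x x = 0) {A Z : Finset Ω} (hAZ : A ⊆ Z)
    (hZ : Z.Nonempty) {r : ℝ} (h : Close D (unif A) (unif (Z \ A)) r) :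
    Close D (unif Z) (unif (Z \ A)) ((A.card / Z.card : ℝ) * r) := by
  have hcard : (Z.card : ℝ) ≠ 0 := by exact_mod_cast hZ.card_pos.ne'
  have hsum : (A.card / Z.card : ℝ) + ((Z \ A).card / Z.card : ℝ) = 1 := by
    rw [← add_div, div_eq_one_iff_eq hcard]
    exact_mod_cast (add_comm _ _).trans (Finset.card_sdiff_add_card_eq_card hAZ)
  have key := Close.mixture (D := D) Finset.univ
    (t := fun b : Bool => if b then (A.card / Z.card : ℝ) else ((Z \ A).card / Z.card : ℝ))
    (fun b _ => by split_ifs <;> positivity)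
    (μ := fun b => if b then unif A else unif (Z \ A)) (ν := fun _ => unif (Z \ A))
    (r := fun b => if b then r else 0)
    (fun b _ => by cases b; exacts [by simpa using Close.refl hD (unif_nonneg _), by simpa using h])
  simp only [Fintype.sum_bool, if_true, Bool.false_eq_true, if_false, mul_zero, add_zero,
    ← add_mul, hsum, one_mul] at key
  convert key using 1
  funext x
  by_cases hx : x ∈ A
  · have hA : (A.card : ℝ) ≠ 0 := by exact_mod_cast (Finset.card_pos.2 ⟨x, hx⟩).ne'
    simp only [unif, hAZ hx, hx, if_true, Finset.mem_sdiff, not_true, and_false, if_false]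
    field_simp
    simp
  · by_cases hz : x ∈ Z
    · have h' : x ∈ Z \ A := Finset.mem_sdiff.2 ⟨hz, hx⟩
      have hR : ((Z \ A).card : ℝ) ≠ 0 := by exact_mod_cast (Finset.card_pos.2 ⟨x, h'⟩).ne'
      simp only [unif, hz, hx, h', if_true, if_false]
      field_simp
      simp
    · simp [unif, hz, hx]

theorem Close.unif_image {D : Ω → Ω → ℝ} {A : Finset Ω} {e : Ω → Ω}
    (he : Set.InjOn e A) (hA : A.Nonempty) {r : ℝ} (hr : ∀ x ∈ A, D x (e x) ≤ r) :
    Close D (unif A) (unif (A.image e)) r := by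
  have hcard : (A.card : ℝ) ≠ 0 := by exact_mod_cast hA.card_pos.ne'
  refine ⟨fun x y => if e x = y then unif A x else 0, ?_, ?_, ?_, ?_⟩
  · intro x y
    dsimp only
    split_ifs
    · exact unif_nonneg A x
    · exact le_rfl
  · simp
  · intro y
    by_cases hy : y ∈ A.image e
    · obtain ⟨x, hx, rfl⟩ := Finset.mem_image.1 hy
      rw [Finset.sum_eq_single x]
      · simp only [unif, hx, hy, if_true, Finset.card_image_of_injOn he]
      · intro z _ hz
        by_cases hzA : z ∈ A
        · have : e z ≠ e x := fun h => hz (he hzA hx h)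
          simp [this]
        · simp [unif, hzA]
      · simp
    · simp only [unif, hy, if_false]
      refine Finset.sum_eq_zero fun x _ => ?_
      split_ifs with h1 h2
      · exact absurd (h1 ▸ Finset.mem_image_of_mem e h2) hy
      · rfl
      · rfl
  · calc ∑ x, ∑ y, (if e x = y then unif A x else 0) * D x y = ∑ x ∈ A, (A.card : ℝ)⁻¹ * D x (e x) := by
          simp [ite_mul, unif, Finset.sum_ite_mem]
      _ ≤ ∑ x ∈ A, (A.card : ℝ)⁻¹ * r :=
          Finset.sum_le_sum fun x hx => mul_le_mul_of_nonneg_left (hr x hx) (by positivity)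
      _ = r := by
          rw [Finset.sum_const, nsmul_eq_mul]
          field_simp

/-- A coupling of two weights supported on the range of `e` is itself supported there, so it pulls
back. This transfers couplings of functions to couplings of proper colourings. -/
theorem Close.comap {Ω' : Type*} [Fintype Ω'] [DecidableEq Ω'] {D : Ω → Ω → ℝ} {e : Ω' → Ω}
    (he : Function.Injective e) {A B : Finset Ω'} {r : ℝ}
    (h : Close D (unif (A.image e)) (unif (B.image e)) r) :
    Close (fun x y => D (e x) (e y)) (unif A) (unif B) r := by
  obtain ⟨π, h0, h1, h2, h3⟩ := h
  have mem : ∀ (A : Finset Ω') x, unif (A.image e) (e x) = unif A x := fun A x => by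
    simp [unif, Finset.card_image_of_injective A he, he.eq_iff]
  have zero : ∀ (A : Finset Ω') x, x ∉ Set.range e → unif (A.image e) x = 0 := fun A x hx => by
    have : x ∉ A.image e := fun h => hx (by
      obtain ⟨a, -, rfl⟩ := Finset.mem_image.1 h
      exact ⟨a, rfl⟩)
    simp [unif, this]
  have r0 : ∀ x y, y ∉ Set.range e → π x y = 0 := fun x y hy =>
    (Finset.sum_eq_zero_iff_of_nonneg fun x _ => h0 x y).1 ((h2 y).trans (zero B y hy)) x
      (Finset.mem_univ _)
  have l0 : ∀ x y, x ∉ Set.range e → π x y = 0 := fun x y hx =>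
    (Finset.sum_eq_zero_iff_of_nonneg fun y _ => h0 x y).1 ((h1 x).trans (zero A x hx)) y
      (Finset.mem_univ _)
  refine ⟨fun x y => π (e x) (e y), fun x y => h0 _ _, fun x => ?_, fun y => ?_, ?_⟩
  · rw [← mem, ← h1]
    exact Fintype.sum_of_injective e he _ _ (fun y hy => r0 _ _ hy) fun _ => rfl
  · rw [← mem, ← h2]
    exact Fintype.sum_of_injective e he _ _ (fun x hx => l0 _ _ hx) fun _ => rfl
  · refine le_of_eq_of_le ?_ h3
    refine Fintype.sum_of_injective e he _ _ (fun x hx => ?_) fun x => ?_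
    · exact Finset.sum_eq_zero fun y _ => by rw [l0 x y hx, zero_mul]
    · exact Fintype.sum_of_injective e he _ _ (fun y hy => by rw [r0 _ _ hy, zero_mul]) fun _ => rfl

end Uniform

/-! ### List colourings and the cost of forbidding a colour -/

section ListColouring

variable {V C : Type*} [Fintype V] [Fintype C] [DecidableEq V] [DecidableEq C]

/-- The colourings that agree with `g` outside `S`, are proper inside `S`, and avoid at each
vertex `u` of `S` the colours in `F u`. -/
noncomputable def listCol (G : SimpleGraph V) (S : Finset V) (F : V → Finset C) (g : V → C) :
    Finset (V → C) :=
  open scoped Classical in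
  Finset.univ.filter fun f => (∀ u, u ∉ S → f u = g u) ∧ (∀ u ∈ S, f u ∉ F u) ∧
    ∀ u ∈ S, ∀ v ∈ S, G.Adj u v → f u ≠ f v

theorem mem_listCol {G : SimpleGraph V} {S : Finset V} {F : V → Finset C} {g f : V → C} :
    f ∈ listCol G S F g ↔ (∀ u, u ∉ S → f u = g u) ∧ (∀ u ∈ S, f u ∉ F u) ∧
      ∀ u ∈ S, ∀ v ∈ S, G.Adj u v → f u ≠ f v := by
  simp [listCol]

/-- The neighbours of `w` in `S`. -/
noncomputable def nbrs (G : SimpleGraph V) (S : Finset V) (w : V) : Finset V :=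
  open scoped Classical in S.filter (G.Adj w)

theorem mem_nbrs {G : SimpleGraph V} {S : Finset V} {w u : V} :
    u ∈ nbrs G S w ↔ u ∈ S ∧ G.Adj w u := by
  simp [nbrs]

theorem card_nbrs_le (G : SimpleGraph V) (S : Finset V) (w : V) :
    (nbrs G S w).card ≤ deg G w := by
  classical
  unfold deg
  rw [← G.card_neighborFinset_eq_degree]
  exact Finset.card_le_card fun u hu => by simpa using (mem_nbrs.1 hu).2

/-- Forbid the colour `a` at the vertices of `T`. -/
def forbid (T : Finset V) (a : C) (F : V → Finset C) (u : V) : Finset C :=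
  if u ∈ T then insert a (F u) else F u

/-- At each vertex of `S`, the number of forbidden colours and neighbours in `S` is at most the
degree. -/
def Sparse (G : SimpleGraph V) (S : Finset V) (F : V → Finset C) : Prop :=
  ∀ u ∈ S, (F u).card + (nbrs G S u).card ≤ deg G u

theorem subset_forbid (T : Finset V) (a : C) (F : V → Finset C) (u : V) :
    F u ⊆ forbid T a F u := by
  unfold forbid; split_ifs
  · exact Finset.subset_insert _ _
  · exact subset_rfl

theorem forbid_insert (T : Finset V) (v : V) (a : C) (F : V → Finset C) :
    forbid (insert v T) a F = forbid {v} a (forbid T a F) := by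
  funext u
  by_cases h1 : u = v
  · subst h1; by_cases h2 : u ∈ T <;> simp [forbid, h2]
  · by_cases h2 : u ∈ T <;> simp [forbid, h1, h2]


theorem Sparse.mono {G : SimpleGraph V} {S : Finset V} {F F' : V → Finset C}
    (h : Sparse G S F') (hF : ∀ u, F u ⊆ F' u) : Sparse G S F := fun u hu =>
  (Nat.add_le_add_right (Finset.card_le_card (hF u)) _).trans (h u hu)

/-- Each neighbour of `w` gains at most one forbidden colour and loses the neighbour `w`, so the
invariant survives the recursion. -/
theorem Sparse.erase {G : SimpleGraph V} {S : Finset V} {F : V → Finset C} (h : Sparse G S F)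
    {w : V} (hw : w ∈ S) (a : C) : Sparse G (S.erase w) (forbid (nbrs G S w) a F) := by
  intro u hu
  obtain ⟨huw, huS⟩ := Finset.mem_erase.1 hu
  have hnb : nbrs G (S.erase w) u = (nbrs G S u).erase w := by
    ext x; simp [mem_nbrs, and_assoc]
  have := h u huS
  unfold forbid
  rw [hnb]
  split_ifs with hadj
  · have hmem : w ∈ nbrs G S u := mem_nbrs.2 ⟨hw, (mem_nbrs.1 hadj).2.symm⟩
    have h1 := Finset.card_insert_le a (F u)
    have h2 := Finset.card_erase_add_one hmem
    omega
  · exact (Nat.add_le_add_left (Finset.card_le_card (Finset.erase_subset _ _)) _).trans this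

theorem listCol_mono {G : SimpleGraph V} {S : Finset V} {F F' : V → Finset C}
    (hF : ∀ u, F u ⊆ F' u) (g : V → C) : listCol G S F' g ⊆ listCol G S F g := fun f hf => by
  obtain ⟨h1, h2, h3⟩ := mem_listCol.1 hf
  exact mem_listCol.2 ⟨h1, fun u hu h => h2 u hu (hF u h), h3⟩

theorem listCol_forbid_singleton {G : SimpleGraph V} {S : Finset V} (F : V → Finset C)
    (g : V → C) {w : V} (hw : w ∈ S) (a : C) :
    listCol G S (forbid {w} a F) g
      = listCol G S F g \ (listCol G S F g).filter (· w = a) := by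
  ext f
  simp only [Finset.mem_sdiff, Finset.mem_filter, mem_listCol]
  constructor
  · rintro ⟨h1, h2, h3⟩
    refine ⟨⟨h1, fun u hu h => h2 u hu (subset_forbid _ _ _ _ h), h3⟩, ?_⟩
    rintro ⟨-, hfa⟩
    exact h2 w hw (by simp [forbid, hfa])
  · rintro ⟨⟨h1, h2, h3⟩, h4⟩
    refine ⟨h1, fun u hu => ?_, h3⟩
    unfold forbid
    split_ifs with h
    · rw [Finset.mem_singleton] at h
      subst h
      rw [Finset.mem_insert, not_or]
      exact ⟨fun h => h4 ⟨⟨h1, h2, h3⟩, h⟩, h2 u hu⟩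
    · exact h2 u hu

/-- Fixing the colour of `w` moves `w` out of the set and turns its colour into a constraint on its
neighbours. This is the self-reduction behind the recursion. -/
theorem listCol_filter_eq {G : SimpleGraph V} {S : Finset V} (F : V → Finset C)
    (g : V → C) {w : V} (hw : w ∈ S) {a : C} (ha : a ∉ F w) :
    (listCol G S F g).filter (· w = a)
      = listCol G (S.erase w) (forbid (nbrs G S w) a F) (Function.update g w a) := by
  ext f
  simp only [Finset.mem_filter, mem_listCol]
  constructor
  · rintro ⟨⟨h1, h2, h3⟩, h4⟩
    refine ⟨fun u hu => ?_, fun u hu => ?_, fun u hu v hv => ?_⟩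
    · by_cases huw : u = w
      · subst huw; simp [h4]
      · rw [Function.update_of_ne huw]
        exact h1 u fun h => hu (Finset.mem_erase.2 ⟨huw, h⟩)
    · have huS := Finset.mem_of_mem_erase hu
      unfold forbid
      split_ifs with h
      · rw [Finset.mem_insert, not_or]
        refine ⟨fun h' => ?_, h2 u huS⟩
        exact h3 w hw u huS (mem_nbrs.1 h).2 (h4.trans h'.symm)
      · exact h2 u huS
    · exact h3 u (Finset.mem_of_mem_erase hu) v (Finset.mem_of_mem_erase hv)
  · rintro ⟨h1, h2, h3⟩
    have hfw : f w = a := by simpa using h1 w (by simp)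
    have hne : ∀ u ∈ S, G.Adj w u → f u ≠ a := fun u hu hadj h => by
      refine h2 u (Finset.mem_erase.2 ⟨hadj.ne', hu⟩) ?_
      simp [forbid, mem_nbrs, hu, hadj, h]
    refine ⟨⟨fun u hu => ?_, fun u hu => ?_, fun u hu v hv hadj => ?_⟩, hfw⟩
    · have huw : u ≠ w := fun h => hu (h ▸ hw)
      simpa [huw] using h1 u fun h => hu (Finset.mem_of_mem_erase h)
    · by_cases huw : u = w
      · rw [huw, hfw]; exact ha
      · exact fun h => h2 u (Finset.mem_erase.2 ⟨huw, hu⟩) (subset_forbid _ _ _ _ h)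
    · by_cases huw : u = w
      · subst huw; rw [hfw]; exact (hne v hv hadj).symm
      · by_cases hvw : v = w
        · subst hvw; rw [hfw]; exact hne u hu hadj.symm
        · exact h3 u (Finset.mem_erase.2 ⟨huw, hu⟩) v (Finset.mem_erase.2 ⟨hvw, hv⟩) hadj

/-- The vertex `w` gets any fixed colour in a small part of the list colourings only. -/
theorem mul_card_filter_le {G : SimpleGraph V} {S : Finset V} {F : V → Finset C}
    (hF : Sparse G S F) (g : V → C) {w : V} (hw : w ∈ S) (a : C) :
    (Fintype.card C - deg G w) * ((listCol G S F g).filter (· w = a)).card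
      ≤ (listCol G S F g).card := by
  set A := (listCol G S F g).filter (· w = a) with hA
  -- The colours that `w` may take when the rest of `f` stays fixed; `hav` counts them. The natural
  -- subtraction truncates, so nothing is claimed when the degree exceeds the number of colours.
  let avail : (V → C) → Finset C := fun f => Finset.univ \ (F w ∪ (nbrs G S w).image f)
  have hav : ∀ f, Fintype.card C - deg G w ≤ (avail f).card := by
    intro f
    have h1 : (F w ∪ (nbrs G S w).image f).card ≤ deg G w :=
      (Finset.card_union_le _ _).trans
        ((Nat.add_le_add_left Finset.card_image_le _).trans (hF w hw))
    have h2 := Finset.card_sdiff_add_card_eq_card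
      (Finset.subset_univ (F w ∪ (nbrs G S w).image f))
    rw [Finset.card_univ] at h2
    simp only [avail]
    omega
  calc (Fintype.card C - deg G w) * A.card = ∑ f ∈ A, (Fintype.card C - deg G w) := by
        rw [Finset.sum_const, smul_eq_mul, mul_comm]
    _ ≤ ∑ f ∈ A, (avail f).card := Finset.sum_le_sum fun f _ => hav f
    _ = (A.sigma avail).card := (Finset.card_sigma _ _).symm
    _ ≤ (listCol G S F g).card := by
        -- Recolouring `w` is injective on these pairs: the new colour is read off at `w`, and the
        -- old one was `a`.
        refine Finset.card_le_card_of_injOn (fun p => Function.update p.1 w p.2) ?_ ?_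
        · rintro ⟨f, c⟩ hp
          obtain ⟨hf, hc⟩ := Finset.mem_sigma.1 (Finset.mem_coe.1 hp)
          obtain ⟨h1, h2, h3⟩ := mem_listCol.1 (Finset.mem_filter.1 hf).1
          simp only [avail, Finset.mem_sdiff, Finset.mem_univ, true_and, Finset.mem_union,
            not_or, Finset.mem_image, not_exists, not_and] at hc
          obtain ⟨hc1, hc2⟩ := hc
          refine Finset.mem_coe.2 (mem_listCol.2 ⟨fun u hu => ?_, fun u hu => ?_,
            fun u hu v hv hadj => ?_⟩)
          · have huw : u ≠ w := fun h => hu (h ▸ hw)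
            simpa [huw] using h1 u hu
          · by_cases huw : u = w
            · subst huw; simpa using hc1
            · simpa [huw] using h2 u hu
          · by_cases huw : u = w
            · subst huw
              simpa [hadj.ne'] using Ne.symm (hc2 v (mem_nbrs.2 ⟨hv, hadj⟩))
            · by_cases hvw : v = w
              · subst hvw
                simpa [hadj.ne] using hc2 u (mem_nbrs.2 ⟨hu, hadj.symm⟩)
              · simpa [huw, hvw] using h3 u hu v hv hadj
        · rintro ⟨f, c⟩ hp ⟨f', c'⟩ hp' h
          have hf := (Finset.mem_filter.1 (Finset.mem_sigma.1 (Finset.mem_coe.1 hp)).1).2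
          have hf' := (Finset.mem_filter.1 (Finset.mem_sigma.1 (Finset.mem_coe.1 hp')).1).2
          simp only at h hf hf'
          have hc : c = c' := by simpa using congrFun h w
          have : f = f' := by
            funext u
            by_cases hu : u = w
            · rw [hu, hf, hf']
            · simpa [hu] using congrFun h u
          rw [this, hc]

/-- The Hamming distance, as a real number. -/
def hcost (x y : V → C) : ℝ := hammingDist x y

theorem hcost_self (x : V → C) : hcost x x = 0 := by simp [hcost]

theorem hcost_comm (x y : V → C) : hcost x y = hcost y x := by simp [hcost, hammingDist_comm]

theorem hcost_triangle (x y z : V → C) : hcost x z ≤ hcost x y + hcost y z := by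
  unfold hcost; exact_mod_cast hammingDist_triangle x y z

theorem hcost_update (x : V → C) (w : V) (c : C) : hcost x (Function.update x w c) ≤ 1 := by
  unfold hcost hammingDist
  norm_cast
  refine (Finset.card_le_card (t := {w}) fun u hu => ?_).trans (by simp)
  by_contra h
  simp_all

/-- Forbidding a colour at the vertices of a set costs at most the sum of the costs at the
single vertices. -/
theorem close_forbid_sum {G : SimpleGraph V} {S T : Finset V} {a : C} {g : V → C} {φ : V → ℝ}
    (h : ∀ F : V → Finset C, Sparse G S F → ∀ u ∈ T, (listCol G S (forbid {u} a F) g).Nonempty →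
      Close hcost (unif (listCol G S F g)) (unif (listCol G S (forbid {u} a F) g)) (φ u))
    {F : V → Finset C} (hF : Sparse G S (forbid T a F))
    (hne : (listCol G S (forbid T a F) g).Nonempty) :
    Close hcost (unif (listCol G S F g)) (unif (listCol G S (forbid T a F) g))
      (∑ u ∈ T, φ u) := by
  induction T using Finset.induction_on with
  | empty =>
    have : forbid ∅ a F = F := by funext u; simp [forbid]
    rw [this]
    simpa using Close.refl hcost_self (unif_nonneg _)
  | insert v T hv ih =>
    rw [forbid_insert] at hF hne ⊢
    have hF' := hF.mono (subset_forbid {v} a (forbid T a F))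
    rw [Finset.sum_insert hv, add_comm]
    refine (ih (fun F hF u hu => h F hF u (Finset.mem_insert_of_mem hu)) hF'
      (hne.mono (listCol_mono (subset_forbid _ _ _) g))).trans hcost_triangle ?_
    exact h _ hF' v (Finset.mem_insert_self _ _) hne

/-- A change of the colour of a vertex `w` outside `S`, whose neighbours in `S` are in `T`. -/
theorem close_recolour {G : SimpleGraph V} {S T : Finset V} {w : V} (hw : w ∉ S) {φ : V → ℝ}
    (h : ∀ (a : C) (g : V → C) (F : V → Finset C), Sparse G S F → ∀ u ∈ T,
      (listCol G S (forbid {u} a F) g).Nonempty →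
      Close hcost (unif (listCol G S F g)) (unif (listCol G S (forbid {u} a F) g)) (φ u))
    {a b : C} {F : V → Finset C} {g : V → C}
    (hFa : Sparse G S (forbid T a F)) (hFb : Sparse G S (forbid T b F))
    (ha : (listCol G S (forbid T a F) (Function.update g w a)).Nonempty)
    (hb : (listCol G S (forbid T b F) (Function.update g w b)).Nonempty) :
    Close hcost (unif (listCol G S (forbid T a F) (Function.update g w a)))
      (unif (listCol G S (forbid T b F) (Function.update g w b))) (1 + 2 * ∑ u ∈ T, φ u) := by
  -- Three legs: lift the colour `a` on `T`, recolour `w` by a bijection at cost 1, then forbid `b`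
  -- on `T`. The outer legs account for the factor 2.
  have c1 := (close_forbid_sum (h a _) hFa ha).symm hcost_comm
  have c3 := close_forbid_sum (h b _) hFb hb
  have himg : listCol G S F (Function.update g w b)
      = (listCol G S F (Function.update g w a)).image (fun f => Function.update f w b) := by
    have aux : ∀ (c c' : C) (f : V → C), f ∈ listCol G S F (Function.update g w c) →
        Function.update f w c' ∈ listCol G S F (Function.update g w c') := by
      intro c c' f hf
      obtain ⟨h1, h2, h3⟩ := mem_listCol.1 hf
      have hS : ∀ u ∈ S, Function.update f w c' u = f u := fun u hu =>
        Function.update_of_ne (fun huw : u = w => hw (huw ▸ hu)) _ _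
      refine mem_listCol.2 ⟨fun u hu => ?_, fun u hu => ?_, fun u hu v hv => ?_⟩
      · by_cases huw : u = w
        · subst huw; simp
        · simpa [huw] using h1 u hu
      · rw [hS u hu]; exact h2 u hu
      · rw [hS u hu, hS v hv]; exact h3 u hu v hv
    ext f
    refine ⟨fun hf => Finset.mem_image.2 ⟨_, aux b a f hf, ?_⟩, fun hf => ?_⟩
    · have : f w = b := by simpa using (mem_listCol.1 hf).1 w hw
      simp [← this]
    · obtain ⟨f', hf', rfl⟩ := Finset.mem_image.1 hf
      exact aux a b f' hf'
  have c2 : Close hcost (unif (listCol G S F (Function.update g w a)))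
      (unif (listCol G S F (Function.update g w b))) 1 := by
    rw [himg]
    refine Close.unif_image ?_ (ha.mono (listCol_mono (subset_forbid _ _ _) _))
      fun x _ => hcost_update x w b
    intro f hf f' hf' hff
    have e : ∀ f ∈ listCol G S F (Function.update g w a), f w = a := fun f hf => by
      simpa using (mem_listCol.1 hf).1 w hw
    funext u
    by_cases hu : u = w
    · rw [hu, e f hf, e f' hf']
    · simpa [hu] using congrFun hff u
  refine ((c1.trans hcost_triangle c2).trans hcost_triangle c3).mono (le_of_eq ?_)
  ring

/-- The recursion for the cost of forbidding a colour at a single vertex. -/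
theorem close_forbid_singleton {G : SimpleGraph V} {S : Finset V} {w : V} (hw : w ∈ S)
    {φ : V → ℝ} (hφ : ∀ u ∈ nbrs G S w, 0 ≤ φ u)
    (h : ∀ (a : C) (g : V → C) (F : V → Finset C), Sparse G (S.erase w) F → ∀ u ∈ nbrs G S w,
      (listCol G (S.erase w) (forbid {u} a F) g).Nonempty →
      Close hcost (unif (listCol G (S.erase w) F g))
        (unif (listCol G (S.erase w) (forbid {u} a F) g)) (φ u))
    {ρ : ℝ} (hρ : 0 ≤ ρ) (hρ' : 1 ≤ ρ ∨ 1 ≤ ρ * ((Fintype.card C : ℝ) - deg G w))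
    {a : C} {F : V → Finset C} {g : V → C} (hF : Sparse G S F)
    (hne : (listCol G S (forbid {w} a F) g).Nonempty) :
    Close hcost (unif (listCol G S F g)) (unif (listCol G S (forbid {w} a F) g))
      (ρ * (1 + 2 * ∑ u ∈ nbrs G S w, φ u)) := by
  have hr : 0 ≤ 1 + 2 * ∑ u ∈ nbrs G S w, φ u := by
    have := Finset.sum_nonneg hφ
    positivity
  have hZ := hne.mono (listCol_mono (subset_forbid _ _ _) g)
  have hZ0 : (0 : ℝ) < (listCol G S F g).card := by exact_mod_cast hZ.card_pos
  -- `ρ` bounds the probability that `w` gets the colour `a`: trivially if `1 ≤ ρ`, otherwise by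
  -- counting free colours.
  have hratio : (((listCol G S F g).filter (· w = a)).card / (listCol G S F g).card : ℝ) ≤ ρ := by
    rw [div_le_iff₀ hZ0]
    rcases hρ' with h1 | h1
    · have : (((listCol G S F g).filter (· w = a)).card : ℝ) ≤ (listCol G S F g).card := by
        exact_mod_cast Finset.card_le_card (Finset.filter_subset _ _)
      nlinarith
    · have hpos : deg G w ≤ Fintype.card C := by
        by_contra hlt
        push Not at hlt
        have : (Fintype.card C : ℝ) < deg G w := by exact_mod_cast hlt
        nlinarith
      have h2 : ((Fintype.card C : ℝ) - deg G w) * ((listCol G S F g).filter (· w = a)).card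
          ≤ (listCol G S F g).card := by
        rw [← Nat.cast_sub hpos]
        exact_mod_cast mul_card_filter_le hF g hw a
      have h3 : (0 : ℝ) ≤ ((listCol G S F g).filter (· w = a)).card := Nat.cast_nonneg _
      nlinarith [mul_le_mul_of_nonneg_left h2 hρ, mul_le_mul_of_nonneg_right h1 h3]
  -- If no colouring uses `a` at `w`, forbidding it changes nothing; below, `close_recolour` needs
  -- this set nonempty.
  rcases ((listCol G S F g).filter (· w = a)).eq_empty_or_nonempty with hA | hA
  · rw [listCol_forbid_singleton F g hw a, hA, Finset.sdiff_empty]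
    exact (Close.refl hcost_self (unif_nonneg _)).mono (mul_nonneg hρ hr)
  have hfw : ∀ c, ((listCol G S F g).filter (· w = c)).Nonempty → c ∉ F w := by
    rintro c ⟨f, hf⟩
    have hf' := Finset.mem_filter.1 hf
    rw [← hf'.2]
    exact (mem_listCol.1 hf'.1).2.1 w hw
  have main : Close hcost (unif ((listCol G S F g).filter (· w = a)))
      (unif (listCol G S (forbid {w} a F) g)) (1 + 2 * ∑ u ∈ nbrs G S w, φ u) := by
    -- Condition on the new colour `c` of `w`: what remains is a change of `w` from `a` to `c`, seen
    -- from `S.erase w`.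
    refine Close.unif_fibres hne (fun f => f w) fun c hc => ?_
    have hca : c ≠ a := by
      rintro rfl
      obtain ⟨f, hf⟩ := hc
      have hf' := Finset.mem_filter.1 hf
      exact (mem_listCol.1 hf'.1).2.1 w hw (by simp [forbid, hf'.2])
    have heq : (listCol G S (forbid {w} a F) g).filter (· w = c)
        = (listCol G S F g).filter (· w = c) := by
      ext f
      rw [listCol_forbid_singleton F g hw a]
      simp only [Finset.mem_filter, Finset.mem_sdiff]
      constructor
      · rintro ⟨⟨h1, -⟩, h2⟩; exact ⟨h1, h2⟩
      · rintro ⟨h1, h2⟩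
        exact ⟨⟨h1, fun h => hca (h2.symm.trans h.2)⟩, h2⟩
    rw [heq] at hc ⊢
    have hFa := hfw a hA
    have hFc := hfw c hc
    rw [listCol_filter_eq F g hw hFa] at hA ⊢
    rw [listCol_filter_eq F g hw hFc] at hc ⊢
    exact close_recolour (by simp) h (hF.erase hw a) (hF.erase hw c) hA hc
  rw [listCol_forbid_singleton F g hw a] at main ⊢
  exact (Close.unif_subset hcost_self (Finset.filter_subset _ _) hZ main).mono
    (mul_le_mul_of_nonneg_right hratio hr)

end ListColouring

/-! ### Solving the recursion with path weights -/

section PathBound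

variable {V : Type*} [Fintype V]

theorem weight_pos {G : SimpleGraph V} {d α γ c : ℝ} (hd : 0 < d) (hα : 0 ≤ α) (hγ : 0 < γ)
    (u : V) : 0 < weight G d α γ c u := by
  unfold weight
  split_ifs with h
  · positivity
  · have : 0 ≤ (1 + α) * d := by positivity
    have h' : 0 < (deg G u : ℝ) := by linarith
    positivity

theorem pathWeight_pos {G : SimpleGraph V} {d α γ c : ℝ} (hd : 0 < d) (hα : 0 ≤ α) (hγ : 0 < γ)
    {u v : V} (p : G.Walk u v) : 0 < pathWeight G d α γ c p :=
  List.prod_pos fun x hx => by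
    obtain ⟨y, -, rfl⟩ := List.mem_map.1 hx
    exact weight_pos hd hα hγ y

theorem pathWeight_concat {G : SimpleGraph V} {d α γ c : ℝ} {u v w : V} (p : G.Walk u v)
    (h : G.Adj v w) :
    pathWeight G d α γ c (p.concat h) = pathWeight G d α γ c p * weight G d α γ c w := by
  simp [pathWeight, SimpleGraph.Walk.support_concat]

theorem two_pow_ten_le {d : ℝ} (hd : 2 ≤ d) : 1024 ≤ d ^ (10 : ℝ) := by
  have h : d ^ (10 : ℝ) = d ^ (10 : ℕ) := by exact_mod_cast Real.rpow_natCast d 10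
  rw [h]
  calc (1024 : ℝ) = 2 ^ 10 := by norm_num
    _ ≤ d ^ 10 := by gcongr

/-- The bound, in terms of the weight of the path that leads to a vertex, on twice the cost of
forbidding a colour at this vertex. -/
noncomputable def costBound (d W : ℝ) : ℝ := (0.82 + 0.01 * W⁻¹) / d

theorem costBound_nonneg {d W : ℝ} (hd : 0 < d) (hW : 0 < W) : 0 ≤ costBound d W := by
  unfold costBound; positivity

/-- With `k - Δ ≥ 4.49 d` and `Δ ≤ 1.01 d`, the constant terms need `1 + 1.01 · 0.82 = 1.8282 ≤ 4.49
· 0.41 = 1.8409`. The coefficients of `W⁻¹` have room to absorb the factor `1 + γ ≤ 1.01`. -/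
theorem costBound_low {d γ W k Δ : ℝ} (hd : 2 ≤ d) (hγ' : γ ≤ 1 / 100) (hW : 0 < W)
    (hk : 11 / 2 * d ≤ k) (hΔ0 : 0 ≤ Δ) (hΔ : Δ ≤ 101 / 100 * d) :
    (k - Δ)⁻¹ * (1 + Δ * costBound d (W * (1 + γ)⁻¹)) ≤ costBound d W / 2 := by
  have hd0 : 0 < d := by linarith
  have hkΔ : 449 / 100 * d ≤ k - Δ := by linarith
  have hy : 0 < W⁻¹ := by positivity
  have h1 : Δ * costBound d (W * (1 + γ)⁻¹) ≤ 101 / 100 * (0.82 + 0.0101 * W⁻¹) := by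
    unfold costBound
    rw [mul_inv, inv_inv, ← mul_div_assoc, div_le_iff₀ hd0]
    have h2 : (0.82 + 0.01 * (W⁻¹ * (1 + γ))) ≤ 0.82 + 0.0101 * W⁻¹ := by nlinarith
    have h3 : 0 ≤ 0.82 + 0.0101 * W⁻¹ := by positivity
    calc Δ * (0.82 + 0.01 * (W⁻¹ * (1 + γ))) ≤ Δ * (0.82 + 0.0101 * W⁻¹) :=
          mul_le_mul_of_nonneg_left h2 hΔ0
      _ ≤ 101 / 100 * d * (0.82 + 0.0101 * W⁻¹) := mul_le_mul_of_nonneg_right hΔ h3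
      _ = _ := by ring
  rw [inv_mul_le_iff₀ (by linarith)]
  calc 1 + Δ * costBound d (W * (1 + γ)⁻¹) ≤ 1 + 101 / 100 * (0.82 + 0.0101 * W⁻¹) := by linarith
    _ ≤ 449 / 100 * (0.82 + 0.01 * W⁻¹) / 2 := by linarith
    _ = 449 / 100 * d * (costBound d W / 2) := by
        unfold costBound; field_simp
    _ ≤ _ := mul_le_mul_of_nonneg_right hkΔ (by have := costBound_nonneg hd0 hW; positivity)

/-- Lightness gives `W⁻¹ ≥ 1024 Δ`, so the term `0.005 W⁻¹` on the right is at least `5.12 Δ`. This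
pays for `d + 0.82 Δ`, and the children's share of `W⁻¹` is smaller by the factor `E`. -/
theorem costBound_high {d W E Δ : ℝ} (hd : 2 ≤ d) (hW : 0 < W) (hE : 1024 ≤ E) (hΔ : d ≤ Δ)
    (h : W * (E * Δ) ≤ 1) :
    1 * (1 + Δ * costBound d (W * (E * Δ))) ≤ costBound d W / 2 := by
  have hd0 : 0 < d := by linarith
  have hΔ0 : 0 < Δ := by linarith
  have hE0 : 0 < E := by linarith
  have hy : 0 < W⁻¹ := by positivity
  have h1 : 1024 * Δ ≤ W⁻¹ := by
    rw [le_inv_comm₀ (by positivity) hW, ← one_div, le_div_iff₀ (by positivity)]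
    nlinarith [mul_le_mul_of_nonneg_left hE (mul_pos hW hΔ0).le]
  have h2 : Δ * costBound d (W * (E * Δ)) = (0.82 * Δ + 0.01 * (W⁻¹ * E⁻¹)) / d := by
    unfold costBound; field_simp
  have h3 : W⁻¹ * E⁻¹ ≤ W⁻¹ * (1 / 1024) := by
    refine mul_le_mul_of_nonneg_left ?_ hy.le
    rw [← one_div]
    exact one_div_le_one_div_of_le (by norm_num) hE
  rw [h2, one_mul]
  unfold costBound
  rw [div_div, mul_comm d 2, ← div_div, ← sub_nonneg]
  have : (0.82 + 0.01 * W⁻¹) / 2 / d - (1 + (0.82 * Δ + 0.01 * (W⁻¹ * E⁻¹)) / d)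
      = ((0.82 + 0.01 * W⁻¹) / 2 - d - (0.82 * Δ + 0.01 * (W⁻¹ * E⁻¹))) / d := by
    field_simp; ring
  rw [this]
  refine div_nonneg ?_ hd0.le
  linarith

/-- The cost of forbidding a colour at a vertex of a set `S` to which a path leads from `s`, if no
path of weight greater than one leads from `s` to a high degree vertex of `S`. -/
theorem close_forbid_of_light {C : Type*} [Fintype C] [DecidableEq V] [DecidableEq C]
    {G : SimpleGraph V} {d α γ : ℝ} (hd : 2 ≤ d) (hγ : 0 < γ)
    (hγα : γ ≤ α) (hα : α ≤ 1 / 100) (hk : 11 / 2 * d ≤ Fintype.card C) {s : V} (n : ℕ) :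
    ∀ S : Finset V, S.card = n →
    (∀ w ∈ S, IsHigh G d α w → ∀ p : G.Walk s w, p.IsPath → ¬ 1 < pathWeight G d α γ 10 p) →
    ∀ {x : V} (q : G.Walk s x), q.IsPath → (∀ u ∈ q.support, u ∉ S) → ∀ w ∈ S, G.Adj x w →
    ∀ (a : C) (g : V → C) (F : V → Finset C), Sparse G S F →
      (listCol G S (forbid {w} a F) g).Nonempty →
      Close hcost (unif (listCol G S F g)) (unif (listCol G S (forbid {w} a F) g))
        (costBound d (pathWeight G d α γ 10 q) / 2) := by
  have hd0 : 0 < d := by linarith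
  have hα0 : 0 ≤ α := by linarith
  induction n with
  | zero =>
    intro S hS _ x q _ _ w hw
    rw [Finset.card_eq_zero] at hS
    simp [hS] at hw
  | succ n ih =>
    intro S hS hlight x q hq hqS w hw hadj a g F hF hne
    have hW := pathWeight_pos (c := 10) hd0 hα0 hγ q
    -- The path avoids `S`, so it stays simple when extended by `w`. Erasing `w` from `S` keeps the
    -- longer path disjoint from the set, and (C) applies to it.
    have hq' : (q.concat hadj).IsPath := hq.concat (fun h => hqS w h hw) hadj
    have hW' := pathWeight_pos (c := 10) hd0 hα0 hγ (q.concat hadj)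
    have hA' := costBound_nonneg hd0 hW'
    have hchild : ∀ (a : C) (g : V → C) (F : V → Finset C), Sparse G (S.erase w) F →
        ∀ u ∈ nbrs G S w, (listCol G (S.erase w) (forbid {u} a F) g).Nonempty →
        Close hcost (unif (listCol G (S.erase w) F g))
          (unif (listCol G (S.erase w) (forbid {u} a F) g))
          (costBound d (pathWeight G d α γ 10 (q.concat hadj)) / 2) := by
      intro a g F hF u hu hne
      obtain ⟨huS, huw⟩ := mem_nbrs.1 hu
      refine ih (S.erase w) (by rw [Finset.card_erase_of_mem hw, hS]; rfl)
        (fun v hv => hlight v (Finset.mem_of_mem_erase hv)) (q.concat hadj) hq' ?_ u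
        (Finset.mem_erase.2 ⟨huw.ne', huS⟩) huw a g F hF hne
      intro v hv hvS
      rw [SimpleGraph.Walk.support_concat, List.mem_append] at hv
      rcases hv with hv | hv
      · exact hqS v hv (Finset.mem_of_mem_erase hvS)
      · simp at hv; simp [hv] at hvS
    have main : ∀ ρ : ℝ, 0 ≤ ρ → (1 ≤ ρ ∨ 1 ≤ ρ * ((Fintype.card C : ℝ) - deg G w)) →
        ρ * (1 + deg G w * costBound d (pathWeight G d α γ 10 q * weight G d α γ 10 w))
          ≤ costBound d (pathWeight G d α γ 10 q) / 2 →
        Close hcost (unif (listCol G S F g)) (unif (listCol G S (forbid {w} a F) g))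
          (costBound d (pathWeight G d α γ 10 q) / 2) := by
      intro ρ hρ hρ' hle
      refine (close_forbid_singleton hw
        (φ := fun _ => costBound d (pathWeight G d α γ 10 (q.concat hadj)) / 2)
        (fun _ _ => by positivity) hchild hρ hρ' hF hne).mono (le_trans ?_ hle)
      rw [Finset.sum_const, nsmul_eq_mul, pathWeight_concat] at *
      refine mul_le_mul_of_nonneg_left ?_ hρ
      have : ((nbrs G S w).card : ℝ) ≤ deg G w := by exact_mod_cast card_nbrs_le G S w
      have := mul_le_mul_of_nonneg_right this hA'
      linarith
    by_cases hlow : (deg G w : ℝ) ≤ (1 + α) * d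
    · have hΔ : (deg G w : ℝ) ≤ 101 / 100 * d := hlow.trans (by nlinarith)
      have hpos : 0 < (Fintype.card C : ℝ) - deg G w := by linarith
      refine main ((Fintype.card C : ℝ) - deg G w)⁻¹ (by positivity) (Or.inr ?_) ?_
      · rw [inv_mul_cancel₀ hpos.ne']
      · rw [show weight G d α γ 10 w = (1 + γ)⁻¹ by unfold weight; rw [if_pos hlow]]
        exact costBound_low hd (by linarith) hW hk (Nat.cast_nonneg _) hΔ
    · have hwt : weight G d α γ 10 w = d ^ (10 : ℝ) * deg G w := by
        unfold weight; rw [if_neg hlow]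
      have hl := hlight w hw (not_le.1 hlow) (q.concat hadj) hq'
      rw [pathWeight_concat, hwt, not_lt] at hl
      refine main 1 zero_le_one (Or.inl le_rfl) ?_
      rw [hwt]
      refine costBound_high hd hW (two_pow_ten_le hd) ?_ hl
      nlinarith [not_le.1 hlow]

end PathBound

/-! ### Counting blocks, and degrees at their boundary -/

section Blocks

variable {V : Type*} [Fintype V]

theorem InfluenceReachable.refl (G : SimpleGraph V) (d α γ c : ℝ) (v : V) :
    InfluenceReachable G d α γ c v v :=
  ⟨SimpleGraph.Walk.nil, SimpleGraph.Walk.IsPath.nil, by simp⟩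

theorem nonempty_of_mem_blocks {G : SimpleGraph V} {d α γ c : ℝ} {B : Finset V}
    (hB : B ∈ blocks G d α γ c) : B.Nonempty := by
  rw [← Finset.coe_nonempty]
  simp only [blocks, Finset.mem_filter, Finset.mem_univ, true_and] at hB
  rcases hB with ⟨v, p, -, h⟩ | ⟨v, -, ⟨-, h⟩ | ⟨-, h⟩⟩
  · exact h ▸ ⟨v, v, p.start_mem_support, .refl G d α γ c v⟩
  · exact h ▸ Set.singleton_nonempty v
  · exact h ▸ ⟨v, .refl G d α γ c v⟩

theorem card_blocks_le {G : SimpleGraph V} {d α γ c : ℝ}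
    (hpart : (blocks G d α γ c : Set (Finset V)).PairwiseDisjoint id) :
    (blocks G d α γ c).card ≤ Fintype.card V := by
  classical
  calc (blocks G d α γ c).card = ∑ B ∈ blocks G d α γ c, 1 := by simp
    _ ≤ ∑ B ∈ blocks G d α γ c, B.card :=
        Finset.sum_le_sum fun B hB => (nonempty_of_mem_blocks hB).card_pos
    _ = ((blocks G d α γ c).biUnion id).card := (Finset.card_biUnion hpart).symm
    _ ≤ Fintype.card V := Finset.card_le_univ _

theorem sum_card_nbrs_le {G : SimpleGraph V} {d α γ c : ℝ}
    (hpart : (blocks G d α γ c : Set (Finset V)).PairwiseDisjoint id) (s : V) :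
    ∑ B ∈ blocks G d α γ c, (nbrs G B s).card ≤ deg G s := by
  classical
  have hsub : ∀ B, nbrs G B s ≤ B := fun B u hu => (mem_nbrs.1 hu).1
  rw [← Finset.card_biUnion (t := fun B => nbrs G B s)
    fun B hB B' hB' hne => (hpart hB hB' hne).mono (hsub B) (hsub B')]
  refine le_trans (Finset.card_le_card fun u hu => ?_) (card_nbrs_le G Finset.univ s)
  obtain ⟨B, -, hu⟩ := Finset.mem_biUnion.1 hu
  exact mem_nbrs.2 ⟨Finset.mem_univ _, (mem_nbrs.1 hu).2⟩

/-- The ends of an edge need two colours, and by (A) at most `d` are used. -/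
theorem IsInFamily.two_le {G : SimpleGraph V} {d α γ : ℝ} (hG : IsInFamily G d α γ) {s w : V}
    (hadj : G.Adj s w) : 2 ≤ d := by
  obtain ⟨m, hm, ⟨f⟩⟩ := hG.colorable
  refine le_trans ?_ hm
  have h : ((f s : Fin m) : ℕ) ≠ f w := fun h => f.valid hadj (Fin.ext h)
  have h1 := (f s).isLt
  have h2 := (f w).isLt
  have : 2 ≤ m := by omega
  exact_mod_cast this

/-- A vertex with a neighbour outside its block is not a high degree vertex. -/
theorem IsInFamily.deg_le {G : SimpleGraph V} {d α γ : ℝ} (hγ : 0 < γ) (hγα : γ ≤ α)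
    (hα : α ≤ 1 / 100) (hG : IsInFamily G d α γ) {B : Finset V} (hB : B ∈ blocks G d α γ 10)
    {s w : V} (hs : s ∈ B) (hw : w ∉ B) (hadj : G.Adj s w) : (deg G s : ℝ) ≤ (1 + α) * d := by
  by_contra hhigh
  have hd := hG.two_le hadj
  have hE := two_pow_ten_le hd
  have hp : (SimpleGraph.Walk.cons hadj.symm (SimpleGraph.Walk.nil : G.Walk s s)).IsPath := by
    simp [hadj.ne']
  refine hG.light_paths B hB w ⟨hw, s, hs, hadj.symm⟩ s hs (not_le.1 hhigh) _ hp ?_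
  -- The contradiction is the one-edge path from `w` to `s`: a high degree vertex weighs at least
  -- `1024 · 2`, any vertex at least `1 / 2`.
  have big : ∀ u, ¬ (deg G u : ℝ) ≤ (1 + α) * d → 2048 ≤ weight G d α γ 10 u := by
    intro u hu
    unfold weight
    rw [if_neg hu]
    have : 2 ≤ (deg G u : ℝ) := by nlinarith [not_le.1 hu]
    nlinarith
  have hws := big s hhigh
  have hww : 1 / 2 ≤ weight G d α γ 10 w := by
    by_cases h : (deg G w : ℝ) ≤ (1 + α) * d
    · unfold weight
      rw [if_pos h, ← one_div]
      exact one_div_le_one_div_of_le (by linarith) (by linarith)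
    · linarith [big w h]
  simp only [pathWeight, SimpleGraph.Walk.support_cons, SimpleGraph.Walk.support_nil,
    List.map_cons, List.map_nil, List.prod_cons, List.prod_nil, mul_one]
  nlinarith

end Blocks

theorem agreeingColourings_congr {V : Type*} [Fintype V] {k : ℕ} {G : SimpleGraph V} {X Y : G.Coloring (Fin k)} {B : Finset V}
    {s : V} (hs : s ∈ B) (hY : ∀ u, u ≠ s → Y u = X u) :
    agreeingColourings G X B = agreeingColourings G Y B := by
  ext W
  simp only [agreeingColourings, Finset.mem_filter, Finset.mem_univ, true_and]
  refine forall₂_congr fun u hu => ?_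
  rw [hY u fun h => hu (h ▸ hs)]

/-! ### Block updates as uniform list colourings -/

section Update

variable {V : Type*} [Fintype V] [DecidableEq V] {k : ℕ}

/-- The colours, in the colouring `X`, of the neighbours of `u` outside `B` other than `s`. -/
noncomputable def outerColours (G : SimpleGraph V) (X : V → Fin k) (B : Finset V) (s u : V) :
    Finset (Fin k) :=
  ((nbrs G (Finset.univ \ B) u).erase s).image X

theorem mem_forbid_outerColours {G : SimpleGraph V} {X Z : V → Fin k} {B : Finset V} {s : V}
    (hs : s ∉ B) (hZ : ∀ u, u ≠ s → Z u = X u) {u : V} (hu : u ∈ B) {a : Fin k} :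
    a ∈ forbid (nbrs G B s) (Z s) (outerColours G X B s) u ↔
      ∃ v, v ∉ B ∧ G.Adj u v ∧ Z v = a := by
  have key : a ∈ outerColours G X B s u ↔ ∃ v, v ≠ s ∧ v ∉ B ∧ G.Adj u v ∧ Z v = a := by
    simp only [outerColours, Finset.mem_image, Finset.mem_erase, mem_nbrs, Finset.mem_sdiff,
      Finset.mem_univ, true_and]
    constructor
    · rintro ⟨v, ⟨h1, h2, h3⟩, h4⟩
      exact ⟨v, h1, h2, h3, (hZ v h1).trans h4⟩
    · rintro ⟨v, h1, h2, h3, h4⟩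
      exact ⟨v, ⟨h1, h2, h3⟩, (hZ v h1).symm.trans h4⟩
  unfold forbid
  split_ifs with h
  · rw [Finset.mem_insert, key]
    constructor
    · rintro (rfl | ⟨v, -, h2⟩)
      · exact ⟨s, hs, (mem_nbrs.1 h).2.symm, rfl⟩
      · exact ⟨v, h2⟩
    · rintro ⟨v, h2, h3, h4⟩
      by_cases hv : v = s
      · exact Or.inl (by rw [← h4, hv])
      · exact Or.inr ⟨v, hv, h2, h3, h4⟩
  · rw [key]
    constructor
    · rintro ⟨v, -, h2⟩
      exact ⟨v, h2⟩
    · rintro ⟨v, h2, h3, h4⟩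
      exact ⟨v, fun hv => h (mem_nbrs.2 ⟨hu, hv ▸ h3.symm⟩), h2, h3, h4⟩

theorem sparse_forbid_outerColours {G : SimpleGraph V} {X Z : V → Fin k} {B : Finset V} {s : V}
    (hs : s ∉ B) (hZ : ∀ u, u ≠ s → Z u = X u) :
    Sparse G B (forbid (nbrs G B s) (Z s) (outerColours G X B s)) := by
  intro u hu
  have hsub : forbid (nbrs G B s) (Z s) (outerColours G X B s) u
      ⊆ (nbrs G (Finset.univ \ B) u).image Z := fun a ha => by
    obtain ⟨v, h1, h2, h3⟩ := (mem_forbid_outerColours hs hZ hu).1 ha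
    exact Finset.mem_image.2 ⟨v, mem_nbrs.2 ⟨by simpa using h1, h2⟩, h3⟩
  have hdisj : Disjoint (nbrs G (Finset.univ \ B) u) (nbrs G B u) :=
    Finset.disjoint_left.2 fun v hv hv' =>
      (Finset.mem_sdiff.1 (mem_nbrs.1 hv).1).2 (mem_nbrs.1 hv').1
  calc _ ≤ (nbrs G (Finset.univ \ B) u).card + (nbrs G B u).card :=
        Nat.add_le_add_right ((Finset.card_le_card hsub).trans Finset.card_image_le) _
    _ = (nbrs G (Finset.univ \ B) u ∪ nbrs G B u).card := (Finset.card_union_of_disjoint hdisj).symm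
    _ ≤ (nbrs G Finset.univ u).card := Finset.card_le_card fun v hv => by
        rcases Finset.mem_union.1 hv with hv | hv <;>
          exact mem_nbrs.2 ⟨Finset.mem_univ _, (mem_nbrs.1 hv).2⟩
    _ ≤ deg G u := card_nbrs_le G _ u

/-- The colour of `s` is kept apart from the other outer colours so that both states share one
family of base lists and differ only in `Z s`, as `close_recolour` requires. -/
theorem image_agreeingColourings {G : SimpleGraph V} {X Z : G.Coloring (Fin k)} {B : Finset V}
    {s : V} (hs : s ∉ B) (hZ : ∀ u, u ≠ s → Z u = X u) :
    (agreeingColourings G Z B).image (fun W : G.Coloring (Fin k) => (W : V → Fin k))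
      = listCol G B (forbid (nbrs G B s) (Z s) (outerColours G X B s))
          (Function.update X s (Z s)) := by
  have hupd : Function.update (X : V → Fin k) s (Z s) = Z := by
    funext u
    by_cases hu : u = s
    · subst hu; simp
    · simp [hu, hZ u hu]
  rw [hupd]
  ext f
  simp only [Finset.mem_image, agreeingColourings, Finset.mem_filter, Finset.mem_univ, true_and,
    mem_listCol]
  constructor
  · rintro ⟨W, hW, rfl⟩
    refine ⟨hW, fun u hu h => ?_, fun u _ v _ hadj => W.valid hadj⟩
    obtain ⟨v, h1, h2, h3⟩ := (mem_forbid_outerColours hs hZ hu).1 h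
    exact W.valid h2 ((h3.symm.trans (hW v h1).symm))
  · rintro ⟨h1, h2, h3⟩
    refine ⟨SimpleGraph.Coloring.mk f fun {u v} hadj => ?_, h1, rfl⟩
    have cross : ∀ u v, u ∈ B → v ∉ B → G.Adj u v → f u ≠ f v := fun u v hu hv hadj h =>
      h2 u hu ((mem_forbid_outerColours hs hZ hu).2 ⟨v, hv, hadj, ((h1 v hv).symm.trans h.symm)⟩)
    by_cases hu : u ∈ B <;> by_cases hv : v ∈ B
    · exact h3 u hu v hv hadj
    · exact cross u v hu hv hadj
    · exact (cross v u hv hu hadj.symm).symm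
    · rw [h1 u hu, h1 v hv]; exact Z.valid hadj

/-- The update of a block that does not contain the disagreement. -/
theorem close_blockUpdate {G : SimpleGraph V} [DecidableEq (G.Coloring (Fin k))] {d α γ : ℝ} (hγ : 0 < γ) (hγα : γ ≤ α) (hα : α ≤ 1 / 100)
    (hG : IsInFamily G d α γ) (hk : 11 / 2 * d ≤ (k : ℝ)) {X Y : G.Coloring (Fin k)} {s : V}
    (hY : ∀ u, u ≠ s → Y u = X u) {B : Finset V} (hB : B ∈ blocks G d α γ 10) (hs : s ∉ B) :
    Close (fun W W' : G.Coloring (Fin k) => hcost (W : V → Fin k) W')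
      (unif (agreeingColourings G X B)) (unif (agreeingColourings G Y B))
      (1 + (nbrs G B s).card * costBound d (weight G d α γ 10 s)) := by
  have hinj : Function.Injective (fun W : G.Coloring (Fin k) => (W : V → Fin k)) :=
    DFunLike.coe_injective
  refine Close.comap hinj ?_
  have neX := (agreeingColourings_nonempty G X B).image (fun W : G.Coloring (Fin k) => (W : V → Fin k))
  have neY := (agreeingColourings_nonempty G Y B).image (fun W : G.Coloring (Fin k) => (W : V → Fin k))
  rw [image_agreeingColourings (X := X) hs fun _ _ => rfl] at neX ⊢
  rw [image_agreeingColourings hs hY] at neY ⊢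
  refine (close_recolour hs (φ := fun _ => costBound d (weight G d α γ 10 s) / 2) ?_
    (sparse_forbid_outerColours hs fun _ _ => rfl) (sparse_forbid_outerColours hs hY)
    neX neY).mono (le_of_eq ?_)
  · intro a g F hF u hu hne
    obtain ⟨huB, hadj⟩ := mem_nbrs.1 hu
    -- The recursion starts from the trivial path at `s`, of weight `W(s)`; (C) supplies the
    -- lightness.
    have := close_forbid_of_light (C := Fin k) (hG.two_le hadj) hγ hγα hα (by simpa using hk)
      B.card B rfl (hG.light_paths B hB s ⟨hs, u, huB, hadj⟩) (SimpleGraph.Walk.nil : G.Walk s s)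
      SimpleGraph.Walk.IsPath.nil (by simpa using hs) u huB hadj a g F hF hne
    simpa [pathWeight] using this
  · rw [Finset.sum_const, nsmul_eq_mul]
    ring

end Update

/-! ### The chain as a mixture over blocks, and the final estimate -/

theorem step_apply_toReal {V : Type*} [Fintype V] [Nonempty V] {G : SimpleGraph V} {d α γ c : ℝ}
    {k : ℕ} [DecidableEq (G.Coloring (Fin k))] (X Z : G.Coloring (Fin k)) :
    (step G d α γ c X Z).toReal = ∑ B ∈ blocks G d α γ c,
      ((blocks G d α γ c).card : ℝ)⁻¹ * unif (agreeingColourings G X B) Z := by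
  classical
  have h : step G d α γ c X Z = ∑ B ∈ blocks G d α γ c,
      ((blocks G d α γ c).card : ENNReal)⁻¹ * blockUpdate G X B Z := by
    rw [step, PMF.bind_apply, tsum_eq_sum (s := blocks G d α γ c)]
    · exact Finset.sum_congr rfl fun B hB => by rw [PMF.uniformOfFinset_apply_of_mem _ hB]
    · intro B hB
      rw [PMF.uniformOfFinset_apply_of_notMem _ hB, zero_mul]
  rw [h, ENNReal.toReal_sum]
  · refine Finset.sum_congr rfl fun B _ => ?_
    rw [ENNReal.toReal_mul, ENNReal.toReal_inv, ENNReal.toReal_natCast, blockUpdate,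
      PMF.uniformOfFinset_apply, unif]
    split_ifs <;> simp
  · intro B hB
    refine ENNReal.mul_ne_top (ENNReal.inv_ne_top.2 ?_) (PMF.apply_ne_top _ _)
    exact_mod_cast (Finset.card_pos.2 ⟨B, hB⟩).ne'

/-- The costs of the updates of all blocks, if a low degree vertex disagrees. -/
theorem mul_costBound_le {d α γ : ℝ} (hd : 2 ≤ d) (hγ : 0 < γ) (hγα : γ ≤ α) (hα : α ≤ 1 / 100)
    {Δ : ℝ} (h : Δ ≤ (1 + α) * d) : Δ * costBound d (1 + γ)⁻¹ ≤ 0.8775 := by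
  have hd0 : 0 < d := by linarith
  calc Δ * costBound d (1 + γ)⁻¹ ≤ (1 + α) * d * costBound d (1 + γ)⁻¹ :=
        mul_le_mul_of_nonneg_right h (costBound_nonneg hd0 (by positivity))
    _ = (1 + α) * (0.82 + 0.01 * (1 + γ)) := by
        unfold costBound; rw [inv_inv]; field_simp
    _ ≤ 0.8775 := by nlinarith

end BlockColouring

open BlockColouring in
theorem theorem5 {V : Type*} [Fintype V] [Nonempty V] (G : SimpleGraph V) (d α γ : ℝ) (k : ℕ)
    (hγ : 0 < γ) (hγα : γ ≤ α) (hα : α ≤ 1 / 100)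
    (hG : BlockColouring.IsInFamily G d α γ)
    (hpart : (BlockColouring.blocks G d α γ 10 : Set (Finset V)).PairwiseDisjoint id)
    (hk : 11 / 2 * d ≤ (k : ℝ))
    (X Y : G.Coloring (Fin k))
    (hXY : hammingDist (X : V → Fin k) (Y : V → Fin k) = 1) :
    ∃ ν : PMF (G.Coloring (Fin k) × G.Coloring (Fin k)),
      BlockColouring.IsCoupling ν
        (BlockColouring.step G d α γ 10 X) (BlockColouring.step G d α γ 10 Y) ∧
      BlockColouring.expectedHamming ν ≤ 1 - 0.1225 / (Fintype.card V : ℝ) := by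
  classical
  obtain ⟨s, hsing⟩ := Finset.card_eq_one.1 hXY
  have hY : ∀ u, u ≠ s → Y u = X u := by
    intro u hu
    by_contra h
    have : u ∈ ({s} : Finset V) := hsing ▸ Finset.mem_filter.2 ⟨Finset.mem_univ u, Ne.symm h⟩
    exact hu (by simpa using this)
  obtain ⟨B₀, hB₀, hsB₀⟩ := exists_mem_blocks G d α γ 10 s
  set 𝓑 := blocks G d α γ 10 with h𝓑
  set κ := costBound d (weight G d α γ 10 s) with hκ
  have hN : (0 : ℝ) < 𝓑.card := by exact_mod_cast Finset.card_pos.2 ⟨B₀, hB₀⟩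
  have hout : ∀ B ∈ 𝓑, s ∈ B → B = B₀ := fun B hB hsB => by
    by_contra hne
    exact Finset.disjoint_left.1 (hpart hB hB₀ hne) hsB hsB₀
  have hclose : ∀ B ∈ 𝓑, Close (fun W W' : G.Coloring (Fin k) => hcost (W : V → Fin k) W')
      (unif (agreeingColourings G X B)) (unif (agreeingColourings G Y B))
      (if B = B₀ then 0 else 1 + (nbrs G B s).card * κ) := by
    intro B hB
    split_ifs with h
    · rw [agreeingColourings_congr (h ▸ hsB₀) hY]
      exact Close.refl (fun W : G.Coloring (Fin k) => hcost_self (W : V → Fin k)) (unif_nonneg _)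
    · exact close_blockUpdate hγ hγα hα hG hk hY hB fun hsB => h (hout B hB hsB)
  have hmix := Close.mixture 𝓑 (t := fun _ => (𝓑.card : ℝ)⁻¹) (fun _ _ => by positivity) hclose
  have hcost_le : ∑ B ∈ 𝓑.erase B₀, ((nbrs G B s).card : ℝ) * κ ≤ 0.8775 := by
    -- An edge from `s` out of its block gives both `2 ≤ d` and low degree of `s`. With no such edge
    -- the sum vanishes.
    by_cases hex : ∃ B ∈ 𝓑.erase B₀, (nbrs G B s).Nonempty
    · obtain ⟨B, hB, w, hw⟩ := hex
      obtain ⟨hBne, hB⟩ := Finset.mem_erase.1 hB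
      obtain ⟨hwB, hadj⟩ := mem_nbrs.1 hw
      have hd := hG.two_le hadj
      have hlow := hG.deg_le hγ hγα hα hB₀ hsB₀
        (fun h => Finset.disjoint_left.1 (hpart hB hB₀ hBne) hwB h) hadj
      have hκ' : κ = costBound d (1 + γ)⁻¹ := by rw [hκ, weight, if_pos hlow]
      rw [← Finset.sum_mul, hκ']
      refine mul_costBound_le hd hγ hγα hα (le_trans ?_ hlow)
      have := (Finset.sum_le_sum_of_subset (f := fun B => (nbrs G B s).card)
        (Finset.erase_subset B₀ 𝓑)).trans (sum_card_nbrs_le hpart s)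
      exact_mod_cast this
    · push Not at hex
      rw [Finset.sum_eq_zero fun B hB => by rw [hex B hB]; simp]
      norm_num
  have hr : ∑ B ∈ 𝓑, (𝓑.card : ℝ)⁻¹ * (if B = B₀ then 0 else 1 + (nbrs G B s).card * κ)
      ≤ 1 - 0.1225 / (Fintype.card V : ℝ) := by
    have hNn : (𝓑.card : ℝ) ≤ Fintype.card V := by exact_mod_cast card_blocks_le hpart
    rw [← Finset.mul_sum, ← Finset.add_sum_erase _ _ hB₀, if_pos rfl, zero_add,
      Finset.sum_congr rfl fun B hB => if_neg (Finset.ne_of_mem_erase hB),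
      Finset.sum_add_distrib, Finset.sum_const, nsmul_eq_mul, mul_one,
      Finset.card_erase_of_mem hB₀, Nat.cast_pred (Finset.card_pos.2 ⟨B₀, hB₀⟩)]
    -- Each block other than `B₀` contributes the surviving disagreement at `s`; the gain over 1 is
    -- `1 - 0.8775` per number of blocks, which is at most `n`.
    calc _ ≤ (𝓑.card : ℝ)⁻¹ * (𝓑.card - 1 + 0.8775) := by gcongr
      _ = 1 - 0.1225 / 𝓑.card := by field_simp; ring
      _ ≤ _ := by gcongr
  simp only [h𝓑, ← step_apply_toReal] at hmix
  obtain ⟨ν, hν, hle⟩ := Close.toPMF hmix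
  refine ⟨ν, hν, le_trans (le_of_eq ?_) (hle.trans hr)⟩
  rw [expectedHamming, Fintype.sum_prod_type]
  rfl
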